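/- \textbf{Notation.} For $m\ge 0$ let $\alpha\in\mathbb S_m$ be a permutation of $\{1,\dots,m\}$. \begin{itemize} \item $c(\alpha)$ is the number of cycles of $\alpha$, fixed points included. \item For $m\ge 1$, $f(\alpha)$ is the number of faces of $\alpha$, that is, the number of cycles of $\alpha^{-1}\circ\sigma$, where $\sigma=(1,2,\dots,m)$ is the standard cycle $1\mapsto 2\mapsto\dots\mapsto m\mapsto 1$ (so $f(\sigma)=m$); for the empty permutation, $f=1$. \item For $U\subseteq\{1,\dots,m\}$, the subpermutation $\alpha|_U$ is the permutation of $U$ that takes each $u\in U$ to the next element of the cycle of $\alpha$ through $u$ that belongs to $U$; it is regarded as an element of $\mathbb S_{|U|}$ by renumbering the elements of $U$ by $1,\dots,|U|$ in increasing order. \item For a positive integer $N$, let $E_{ij}\in\mathfrak{gl}(N)$ be the matrix units over $\mathbb C$, and put $$w_{\mathfrak{gl}(N)}(\alpha)=\sum_{i_1,\dots,i_m=1}^N E_{i_1i_{\alpha(1)}}E_{i_2i_{\alpha(2)}}\cdots E_{i_mi_{\alpha(m)}}\in U\mathfrak{gl}(N).$$ The Casimir elements are $C_k=w_{\mathfrak{gl}(N)}((1,2,\dots,k))\in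 ZU\mathfrak{gl}(N)$, $k=1,2,\dots$. \item The universal $\mathfrak{gl}$-weight system assigns to $\alpha$ the polynomial $w_{\mathfrak{gl}}(\alpha)\in\mathbb C[N,C_1,C_2,\dots]$ which, for every positive integer value of $N$ and with the $C_k$ replaced by the Casimir elements of $U\mathfrak{gl}(N)$, takes the value $w_{\mathfrak{gl}(N)}(\alpha)$. \item $F_\varepsilon(\alpha)\in\mathbb C[N,\varepsilon]$ is the result of the substitution $$C_k:=\frac1N\left((N+\varepsilon)^k-(1-N^2)\varepsilon^k\right),\qquad k=1,2,\dots,$$ in $w_{\mathfrak{gl}}(\alpha)$ (the right-hand side is a polynomial in $N$ and $\varepsilon$). \end{itemize} \textbf{Theorem.} For every $m\ge 0$ and every permutation $\alpha\in\mathbb S_m$, the polynomial $w_{\mathfrak{gl}}(\alpha)$ exists, and $$F_\varepsilon(\alpha)=\sum_{U\subseteq\{1,\dots,m\}}N^{c(\alpha)-c(\alpha|_U)+f(\alpha|_U)-1}\,\varepsilon^{m-|U|}$$ in $\mathbb C[N,\varepsilon]$, where the sum is over all $2^m$ subsets $U$ of $\{1,\dots,m\}$. -/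

import Mathlib

namespace GlWeight

open Equiv

attribute [local instance 100] LieRing.ofAssociativeRing

/-! ### Permutations: cycles, faces, subpermutations -/

/-- `c(α)`: the number of cycles (orbits) of a permutation, fixed points included. -/
noncomputable def numCycles {ι : Type*} (α : Perm ι) : ℕ :=
  Nat.card (Quotient (Perm.SameCycle.setoid α))

/-- `f(α)`: the number of faces of a permutation `α` of `{1, …, m}`, regarded as a one-vertex
hypermap with hypervertex the standard cycle `σ : 1 ↦ 2 ↦ ⋯ ↦ m ↦ 1`: the number of cycles of
`α⁻¹ ∘ σ`. The hypermap of the empty permutation is a disc, which has one face. -/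
noncomputable def numFaces {m : ℕ} (α : Perm (Fin m)) : ℕ :=
  if m = 0 then 1 else numCycles (α⁻¹ * finRotate m)

theorem exists_return {ι : Type*} [Fintype ι] (α : Perm ι) (U : Finset ι) (u : U) :
    ∃ n : ℕ, (α ^ (n + 1)) u ∈ U := by
  refine ⟨orderOf α - 1, ?_⟩
  rw [Nat.sub_add_cancel (orderOf_pos α), pow_orderOf_eq_one]
  simp

/-- The element of `U` that follows `u ∈ U` in the cycle of `α` through `u`. -/
def nextIn {ι : Type*} [Fintype ι] [DecidableEq ι] (α : Perm ι) (U : Finset ι) (u : U) : U :=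
  ⟨(α ^ (Nat.find (exists_return α U u) + 1)) u, Nat.find_spec (exists_return α U u)⟩

theorem nextIn_injective {ι : Type*} [Fintype ι] [DecidableEq ι] (α : Perm ι) (U : Finset ι) :
    Function.Injective (nextIn α U) := by
  have key : ∀ u v : U, Nat.find (exists_return α U u) ≤ Nat.find (exists_return α U v) →
      nextIn α U u = nextIn α U v → u = v := by
    intro u v hle h
    obtain ⟨d, hd⟩ := Nat.exists_eq_add_of_le hle
    have h1 : (α ^ (Nat.find (exists_return α U u) + 1)) (u : ι)
        = (α ^ (Nat.find (exists_return α U v) + 1)) (v : ι) := congrArg Subtype.val h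
    rw [show Nat.find (exists_return α U v) + 1
        = (Nat.find (exists_return α U u) + 1) + d by omega, pow_add α _ d, Perm.mul_apply] at h1
    have h2 : (u : ι) = (α ^ d) (v : ι) := (α ^ _).injective h1
    cases d with
    | zero => exact Subtype.ext (by simpa using h2)
    | succ e =>
      exact absurd (h2 ▸ u.2 : (α ^ (e + 1)) (v : ι) ∈ U)
        (Nat.find_min (exists_return α U v) (by omega))
  intro u v h
  rcases le_total (Nat.find (exists_return α U u)) (Nat.find (exists_return α U v)) with hle | hle
  · exact key u v hle h
  · exact (key v u hle h.symm).symm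

/-- The permutation of the set `U` taking each element of `U` to the next element of its
`α`-cycle that belongs to `U`. -/
noncomputable def inducedPerm {ι : Type*} [Fintype ι] [DecidableEq ι] (α : Perm ι)
    (U : Finset ι) : Perm U :=
  Equiv.ofBijective (nextIn α U) (Finite.injective_iff_bijective.mp (nextIn_injective α U))

/-- The subpermutation `α|_U`, with the elements of `U` renumbered by `1, …, |U|` in increasing
order. -/
noncomputable def subPerm {m : ℕ} (α : Perm (Fin m)) (U : Finset (Fin m)) :
    Perm (Fin U.card) :=
  (U.orderIsoOfFin rfl).toEquiv.symm.permCongr (inducedPerm α U)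

/-! ### The `gl(N)`-weight system -/

/-- The universal enveloping algebra of `gl(N)` over the complex numbers. -/
abbrev Ugl (N : ℕ) : Type :=
  UniversalEnvelopingAlgebra ℂ (Matrix (Fin N) (Fin N) ℂ)

/-- The matrix unit `E_{ij}` as an element of `U gl(N)`. -/
noncomputable def unit (N : ℕ) (i j : Fin N) : Ugl N :=
  UniversalEnvelopingAlgebra.ι ℂ (Matrix.single i j (1 : ℂ))

/-- `w_{gl(N)}(α) = ∑_{i₁, …, i_m} E_{i₁ i_{α(1)}} E_{i₂ i_{α(2)}} ⋯ E_{i_m i_{α(m)}}`. -/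
noncomputable def glNWeight (N : ℕ) {m : ℕ} (α : Perm (Fin m)) : Ugl N :=
  ∑ i : Fin m → Fin N, (List.ofFn fun k => unit N (i k) (i (α k))).prod

/-- The Casimir element `C_k`, the value of `w_{gl(N)}` on the standard cycle of length `k`. -/
noncomputable def casimir (N k : ℕ) : Ugl N :=
  glNWeight N (finRotate k)

/-- The `N × N` matrix over `U gl(N)` with entries `E_{ij}`. -/
noncomputable def unitMatrix (N : ℕ) : Matrix (Fin N) (Fin N) (Ugl N) :=
  Matrix.of (unit N)

theorem unit_comm (N : ℕ) (a b i j : Fin N) :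
    unit N a b * unit N i j - unit N i j * unit N a b
      = (if b = i then unit N a j else 0) - (if j = a then unit N i b else 0) := by
  have h := (UniversalEnvelopingAlgebra.ι ℂ (L := Matrix (Fin N) (Fin N) ℂ)).map_lie
    (Matrix.single a b 1) (Matrix.single i j 1)
  rw [Ring.lie_def, Ring.lie_def, map_sub] at h
  unfold unit
  rw [← h]
  congr 1
  · split_ifs with hb
    · subst hb; simp
    · simp [hb]
  · split_ifs with hb
    · subst hb; simp
    · simp [hb]

theorem unit_comm_pow (N : ℕ) (a b : Fin N) (n : ℕ) (i j : Fin N) :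
    unit N a b * (unitMatrix N ^ n) i j - (unitMatrix N ^ n) i j * unit N a b
      = (if b = i then (unitMatrix N ^ n) a j else 0)
        - (if j = a then (unitMatrix N ^ n) i b else 0) := by
  induction n generalizing i j with
  | zero =>
    by_cases hij : i = j
    · subst hij
      by_cases h1 : b = i
      · subst h1; by_cases h2 : a = b
        · subst h2; simp
        · simp [h2, Ne.symm h2]
      · by_cases h2 : i = a
        · subst h2; simp [h1, Ne.symm h1]
        · simp [h1, h2]
    · by_cases h1 : b = i
      · subst h1; by_cases h2 : a = j
        · subst h2; simp [hij]
        · simp [hij, Ne.symm h2, h2]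
      · by_cases h2 : j = a
        · subst h2; simp [hij, h1, Ne.symm h1]
        · simp [hij, h1, h2]
  | succ n ih =>
    have e : unit N a b * (unitMatrix N ^ (n + 1)) i j
        - (unitMatrix N ^ (n + 1)) i j * unit N a b
        = ∑ c, ((unit N a b * (unitMatrix N ^ n) i c - (unitMatrix N ^ n) i c * unit N a b)
              * unit N c j
            + (unitMatrix N ^ n) i c * (unit N a b * unit N c j - unit N c j * unit N a b)) := by
      rw [pow_succ, Matrix.mul_apply, Finset.mul_sum, Finset.sum_mul, ← Finset.sum_sub_distrib]
      refine Finset.sum_congr rfl fun c _ => ?_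
      simp only [unitMatrix, Matrix.of_apply]
      noncomm_ring
    rw [e]
    simp only [ih, unit_comm]
    simp only [sub_mul, mul_sub, ite_mul, mul_ite, zero_mul, mul_zero, Finset.sum_add_distrib,
      Finset.sum_sub_distrib, Finset.sum_ite_eq, Finset.sum_ite_eq', Finset.mem_univ, if_true,
      pow_succ, Matrix.mul_apply]
    by_cases h1 : b = i <;> by_cases h2 : j = a <;> simp [h1, h2, unitMatrix] <;> abel

theorem pow_unitMatrix (N n : ℕ) (a b : Fin N) :
    (unitMatrix N ^ (n + 1)) a b = ∑ i : Fin n → Fin N,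
      (List.ofFn fun k : Fin (n + 1) => unit N ((Fin.cons a i : Fin (n + 1) → Fin N) k)
        ((Fin.snoc i b : Fin (n + 1) → Fin N) k)).prod := by
  induction n generalizing a with
  | zero => simp [unitMatrix, Fin.snoc]
  | succ n ih =>
    rw [pow_succ', Matrix.mul_apply, ← (Fin.consEquiv fun _ : Fin (n + 1) => Fin N).sum_comp,
      Fintype.sum_prod_type]
    refine Finset.sum_congr rfl fun c _ => ?_
    rw [ih, Finset.mul_sum]
    refine Finset.sum_congr rfl fun i _ => ?_
    rw [List.ofFn_succ, List.prod_cons]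
    simp [Fin.consEquiv, ← Fin.cons_snoc_eq_snoc_cons, unitMatrix]

theorem casimir_succ (N n : ℕ) : casimir N (n + 1) = (unitMatrix N ^ (n + 1)).trace := by
  simp only [Matrix.trace, Matrix.diag_apply, pow_unitMatrix, casimir, glNWeight]
  rw [← (Fin.consEquiv fun _ : Fin (n + 1) => Fin N).sum_comp, Fintype.sum_prod_type]
  refine Finset.sum_congr rfl fun a _ => Finset.sum_congr rfl fun i _ => ?_
  simp only [Fin.snoc_eq_cons_rotate]
  rfl

theorem mem_center_of_commute (N : ℕ) (z : Ugl N)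
    (hz : ∀ a b : Fin N, unit N a b * z = z * unit N a b) :
    z ∈ Subalgebra.center ℂ (Ugl N) := by
  let S : Subalgebra ℂ (Ugl N) := Subalgebra.centralizer ℂ {z}
  have hι : ∀ x, UniversalEnvelopingAlgebra.ι ℂ x ∈ S := by
    intro x
    rw [Matrix.matrix_eq_sum_single x, map_sum]
    refine sum_mem fun a _ => ?_
    rw [map_sum]
    refine sum_mem fun b _ => ?_
    have : Matrix.single a b (x a b) = x a b • Matrix.single a b (1 : ℂ) := by simp
    rw [this, map_smul]
    refine S.smul_mem ?_ _
    rw [Subalgebra.mem_centralizer_iff]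
    rintro _ rfl
    exact (hz a b).symm
  let g : Matrix (Fin N) (Fin N) ℂ →ₗ⁅ℂ⁆ S :=
    { toFun := fun x => ⟨UniversalEnvelopingAlgebra.ι ℂ x, hι x⟩
      map_add' := fun x y => Subtype.ext (by simp)
      map_smul' := fun c x => Subtype.ext (by simp)
      map_lie' := fun {x y} => Subtype.ext ((UniversalEnvelopingAlgebra.ι ℂ).map_lie x y) }
  have hid : S.val.comp (UniversalEnvelopingAlgebra.lift ℂ g) = AlgHom.id ℂ (Ugl N) := by
    apply UniversalEnvelopingAlgebra.hom_ext
    ext x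
    simp [g]
  rw [Subalgebra.mem_center_iff]
  intro y
  have hy : y ∈ S := by
    have := congrArg (fun φ : Ugl N →ₐ[ℂ] Ugl N => φ y) hid
    simp only [AlgHom.comp_apply, AlgHom.id_apply] at this
    rw [← this]
    exact (UniversalEnvelopingAlgebra.lift ℂ g y).2
  exact ((Subalgebra.mem_centralizer_iff ℂ).mp hy z rfl).symm

/-- Casimir elements are central. -/
theorem casimir_mem_center (N k : ℕ) : casimir N k ∈ Subalgebra.center ℂ (Ugl N) := by
  apply mem_center_of_commute
  intro a b
  cases k with
  | zero => simp [casimir, glNWeight]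
  | succ n =>
    rw [← sub_eq_zero, casimir_succ, Matrix.trace, Finset.mul_sum, Finset.sum_mul,
      ← Finset.sum_sub_distrib]
    simp [unit_comm_pow, Finset.sum_sub_distrib]

/-- The values in the centre `ZU gl(N)` of the variables `C₀ = N, C₁, C₂, …`: the number `N` and
the Casimir elements. -/
noncomputable def casimirPoint (N k : ℕ) : Subalgebra.center ℂ (Ugl N) :=
  if k = 0 then (N : Subalgebra.center ℂ (Ugl N)) else ⟨casimir N k, casimir_mem_center N k⟩

/-! ### The universal `gl`-weight system

Polynomials in `N, C₁, C₂, …` are elements of `MvPolynomial ℕ ℂ`: the variable `X 0` is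
`N = C₀`, and the variable `X k` is `C_k` for `k ≥ 1`. -/

/-- `P ∈ ℂ[N, C₁, C₂, …]` specializes to `w_{gl(N)}(α)` for every `N = 1, 2, …`. -/
def IsUniversalValue {m : ℕ} (α : Perm (Fin m)) (P : MvPolynomial ℕ ℂ) : Prop :=
  ∀ N : ℕ, 1 ≤ N → ((MvPolynomial.aeval (casimirPoint N) P : Subalgebra.center ℂ (Ugl N)) : Ugl N)
    = glNWeight N α

/-- The universal `gl`-weight system `w_gl(α) ∈ ℂ[N, C₁, C₂, …]`: the polynomial that specializes
to `w_{gl(N)}(α)` for all `N = 1, 2, …`. (It is unique, as `C₁, …, C_N` are algebraically independent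
in `U gl(N)`.) -/
noncomputable def wgl {m : ℕ} (α : Perm (Fin m)) : MvPolynomial ℕ ℂ :=
  Classical.epsilon (IsUniversalValue α)

/-! ### The two-parameter family -/

/-- The variable `N` of `ℂ[N, ε]`. -/
noncomputable def varN : MvPolynomial (Fin 2) ℂ := MvPolynomial.X 0

/-- The variable `ε` of `ℂ[N, ε]`. -/
noncomputable def varE : MvPolynomial (Fin 2) ℂ := MvPolynomial.X 1

/-- The polynomial `((N + ε)^k - (1 - N²) ε^k) / N`, with the division by `N` carried out; see
`varN_mul_casimirSubst`. -/
noncomputable def casimirSubst (k : ℕ) : MvPolynomial (Fin 2) ℂ :=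
  (∑ i ∈ Finset.range k, (k.choose (i + 1) : MvPolynomial (Fin 2) ℂ)
    * varN ^ i * varE ^ (k - (i + 1))) + varN * varE ^ k

/-- The polynomial `casimirSubst k` is the quotient of `(N + ε)^k - (1 - N²) ε^k` by `N`. -/
theorem varN_mul_casimirSubst (k : ℕ) :
    varN * casimirSubst k = (varN + varE) ^ k - (1 - varN ^ 2) * varE ^ k := by
  rw [add_pow, Finset.sum_range_succ', casimirSubst, mul_add, Finset.mul_sum]
  have : ∀ i, varN * ((k.choose (i + 1) : MvPolynomial (Fin 2) ℂ) * varN ^ i * varE ^ (k - (i + 1)))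
      = varN ^ (i + 1) * varE ^ (k - (i + 1)) * (k.choose (i + 1) : MvPolynomial (Fin 2) ℂ) := by
    intro i; ring
  simp only [this]
  simp
  ring

/-- `F_ε(α) ∈ ℂ[N, ε]`: the result of the substitution
`C_k := ((N + ε)^k - (1 - N²) ε^k) / N`, `k = 1, 2, …`, in `w_gl(α)`. -/
noncomputable def Feps {m : ℕ} (α : Perm (Fin m)) : MvPolynomial (Fin 2) ℂ :=
  MvPolynomial.aeval (fun k : ℕ => if k = 0 then varN else casimirSubst k) (wgl α)

end GlWeight

namespace GlWeight

open Equiv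

attribute [local instance 100] LieRing.ofAssociativeRing

/-! ### Products of matrix units -/

/-! Existence. The families indexed by N that come from one polynomial in N and the Casimirs form a
subalgebra (`universalFamilies`). Conjugating α by a neighbouring transposition exchanges two
adjacent letters in every word. The commutators that appear sum to weights of permutations of one
point fewer, possibly times N. By induction, membership therefore depends only on the conjugacy
class (`glWeights_conj_mem_iff`). A transitive permutation is conjugate to the standard cycle, a
Casimir; any other is conjugate to a block sum, whose weight is a product.

Formula. Let gl(N) act on ℂ^N by E_ij ↦ e_ij + ε δ_ij. Then C_k acts by the scalar substituted for
it in F_ε (`twistedRep_casimir`), so the trace of w(α) is N · F_ε(α). The same trace can be expanded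
directly: U collects the letters that contribute e_ij, and the others contribute ε δ_ij. The summand
of U counts pairs (i, j) of index functions, i attached to α and j to the rotation σ of the trace.
Off U, i is constant along α and j along σ; on U they are glued. Cycles of α missing U give N^(c(α)
- c(α|_U)), and the glued part gives N^f(α|_U) (`sum_prod_ite_eq`). Dividing by N gives the formula
at all positive integers N and all ε, which determines the polynomial. Only the values of `wgl α`
are used, so its uniqueness plays no role. -/

/-- The product `E_{u_1 v_1} E_{u_2 v_2} ⋯ E_{u_n v_n}`. -/
noncomputable def unitWord (N : ℕ) {n : ℕ} (u v : Fin n → Fin N) : Ugl N :=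
  (List.ofFn fun k => unit N (u k) (v k)).prod

theorem glNWeight_eq_sum_unitWord (N : ℕ) {m : ℕ} (α : Perm (Fin m)) :
    glNWeight N α = ∑ i : Fin m → Fin N, unitWord N i (i ∘ α) := rfl

theorem unitWord_succ (N : ℕ) {n : ℕ} (u v : Fin (n + 1) → Fin N) :
    unitWord N u v = unit N (u 0) (v 0) * unitWord N (u ∘ Fin.succ) (v ∘ Fin.succ) := by
  simp [unitWord, List.ofFn_succ]

theorem unitWord_append (N : ℕ) {a b : ℕ} (u v : Fin a → Fin N) (u' v' : Fin b → Fin N) :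
    unitWord N (Fin.append u u') (Fin.append v v') = unitWord N u v * unitWord N u' v' := by
  rw [unitWord, unitWord, unitWord, ← List.prod_append, ← List.ofFn_fin_append]
  congr 2
  funext k
  refine Fin.addCases (fun k => ?_) (fun k => ?_) k <;> simp

theorem swap_succ_succ_apply_succ {n : ℕ} (k l x : Fin n) :
    swap k.succ l.succ x.succ = (swap k l x).succ := by
  simp only [swap_apply_def, Fin.succ_inj]
  split_ifs <;> rfl

/-- The commutation relation for two neighbouring letters of a word in the matrix units. -/
theorem unitWord_sub_unitWord_swap (N : ℕ) {n : ℕ} (k : Fin n) (u v : Fin (n + 1) → Fin N) :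
    unitWord N u v
        - unitWord N (u ∘ swap k.castSucc k.succ) (v ∘ swap k.castSucc k.succ)
      = (if u k.succ = v k.castSucc
          then unitWord N (u ∘ k.succ.succAbove) (v ∘ k.castSucc.succAbove) else 0)
        - (if u k.castSucc = v k.succ
          then unitWord N (u ∘ k.castSucc.succAbove) (v ∘ k.succ.succAbove) else 0) := by
  induction n with
  | zero => exact k.elim0
  | succ n ih =>
    cases k using Fin.cases with
    | zero =>
      have h0 : ∀ w : Fin (n + 2) → Fin N,
          (w ∘ swap (Fin.castSucc 0) (Fin.succ 0)) ∘ Fin.succ ∘ Fin.succ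
            = w ∘ Fin.succ ∘ Fin.succ := by
        intro w
        funext x
        simp only [Function.comp_apply]
        rw [swap_apply_of_ne_of_ne]
        · exact Fin.succ_ne_zero _
        · exact fun h => Fin.succ_ne_zero _ (Fin.succ_injective _ h)
      have h1 : ∀ w : Fin (n + 2) → Fin N,
          (w ∘ (Fin.succ 0 : Fin (n + 2)).succAbove) ∘ Fin.succ = w ∘ Fin.succ ∘ Fin.succ := by
        intro w; funext x; simp
      have h2 : ∀ w : Fin (n + 2) → Fin N,
          (w ∘ (Fin.castSucc 0 : Fin (n + 2)).succAbove) ∘ Fin.succ = w ∘ Fin.succ ∘ Fin.succ := by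
        intro w; funext x; simp
      simp only [unitWord_succ, Function.comp_assoc] at h0 h1 h2 ⊢
      simp only [h0, h1, h2]
      have e1 : ∀ w : Fin (n + 2) → Fin N, (w ∘ swap (Fin.castSucc 0) (Fin.succ 0)) 0 = w 1 := by
        intro w; simp
      have e2 : ∀ w : Fin (n + 2) → Fin N,
          (w ∘ ⇑(swap (Fin.castSucc 0) (Fin.succ 0)) ∘ Fin.succ) 0 = w 0 := by
        intro w; simp
      simp only [e1, e2]
      rw [← mul_assoc, ← mul_assoc, ← sub_mul]
      simp only [Function.comp_apply, Fin.castSucc_zero, Fin.succAbove_zero, Fin.succ_zero_eq_one,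
        Fin.one_succAbove_zero]
      rw [unit_comm, sub_mul, ite_mul, ite_mul, zero_mul]
      simp only [eq_comm (a := v 0) (b := u 1), eq_comm (a := v 1) (b := u 0)]
      rfl
    | succ k =>
      have h0 : ∀ w : Fin (n + 2) → Fin N,
          (w ∘ swap k.succ.castSucc k.succ.succ) ∘ Fin.succ
            = (w ∘ Fin.succ) ∘ swap k.castSucc k.succ := by
        intro w
        funext x
        simp only [Function.comp_apply, Fin.castSucc_succ, swap_succ_succ_apply_succ]
      have h1 : ∀ (w : Fin (n + 2) → Fin N) (p : Fin (n + 1)),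
          (w ∘ p.succ.succAbove) ∘ Fin.succ = (w ∘ Fin.succ) ∘ p.succAbove := by
        intro w p; funext x; simp
      have e1 : ∀ w : Fin (n + 2) → Fin N,
          (w ∘ swap k.succ.castSucc k.succ.succ) 0 = w 0 := by
        intro w
        simp only [Function.comp_apply]
        rw [swap_apply_of_ne_of_ne]
        · rw [Fin.castSucc_succ]
          exact (Fin.succ_ne_zero _).symm
        · exact (Fin.succ_ne_zero _).symm
      rw [unitWord_succ N u v, unitWord_succ N (u ∘ swap k.succ.castSucc k.succ.succ), h0, h0, e1,
        e1, ← mul_sub, ih k, mul_sub, mul_ite, mul_ite, mul_zero,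
        unitWord_succ N (u ∘ k.succ.succ.succAbove), unitWord_succ N (u ∘ k.succ.castSucc.succAbove)]
      simp only [Fin.castSucc_succ, h1]
      simp

/-! ### The algebra of universal families -/

/-- The families of elements of the algebras `U gl(N)` that are the values of a polynomial in `N`
and the Casimir elements. -/
noncomputable def universalFamilies : Subalgebra ℂ (∀ N, Ugl N) :=
  (AlgHom.pi fun N => (Subalgebra.center ℂ (Ugl N)).val.comp
    (MvPolynomial.aeval (casimirPoint N))).range

/-- The values of the `gl(N)`-weight systems, for all `N`, on a permutation. -/
noncomputable def glWeights {m : ℕ} (α : Perm (Fin m)) : ∀ N, Ugl N := fun N => glNWeight N α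

theorem mem_universalFamilies {x : ∀ N, Ugl N} :
    x ∈ universalFamilies ↔ ∃ P : MvPolynomial ℕ ℂ, ∀ N,
      ((MvPolynomial.aeval (casimirPoint N) P : Subalgebra.center ℂ (Ugl N)) : Ugl N) = x N := by
  simp only [universalFamilies, AlgHom.mem_range, funext_iff]
  rfl

theorem exists_isUniversalValue {m : ℕ} {α : Perm (Fin m)} (h : glWeights α ∈ universalFamilies) :
    ∃ P, IsUniversalValue α P := by
  obtain ⟨P, hP⟩ := mem_universalFamilies.mp h
  exact ⟨P, fun N _ => hP N⟩

theorem natCast_mem_universalFamilies : (fun N => (N : Ugl N)) ∈ universalFamilies :=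
  mem_universalFamilies.mpr ⟨MvPolynomial.X 0, fun N => by simp [casimirPoint]⟩

theorem glWeights_finRotate_mem (m : ℕ) : glWeights (finRotate m) ∈ universalFamilies := by
  cases m with
  -- The variable of index 0 stands for N, not for the weight of the empty cycle, which is 1.
  | zero =>
    have : glWeights (finRotate 0) = 1 := by
      funext N
      simp [glWeights, glNWeight]
    rw [this]
    exact one_mem _
  | succ m =>
    exact mem_universalFamilies.mpr ⟨MvPolynomial.X (m + 1), fun N => by
      simp [casimirPoint, casimir, glWeights]⟩

theorem sum_insertNth {N n : ℕ} {M : Type*} [AddCommMonoid M] (p : Fin (n + 1))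
    (F : (Fin (n + 1) → Fin N) → M) :
    ∑ i, F i = ∑ x : Fin N, ∑ i : Fin n → Fin N, F (p.insertNth x i) := by
  rw [← (Fin.insertNthEquiv (fun _ => Fin N) p).sum_comp, Fintype.sum_prod_type]
  rfl

/-- Giving p the same index as the r-th remaining point means pulling an index function back along
the map that merges these two points. -/
theorem insertNth_comp_right {N n : ℕ} (p : Fin (n + 1)) (r : Fin n) (i : Fin n → Fin N) :
    (p.insertNth (i r) i : Fin (n + 1) → Fin N)
      = i ∘ (p.insertNth r id : Fin (n + 1) → Fin n) := by
  funext x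
  refine Fin.succAboveCases p ?_ (fun y => ?_) x <;> simp

/-- Deleting the source `q` and the target `p` from `α`, and identifying `p` with `α q`, gives a
permutation. -/
theorem bijective_insertNth_comp {n : ℕ} (α : Perm (Fin (n + 1))) (p q : Fin (n + 1)) (r : Fin n)
    (h : α q = p ∨ α q = p.succAbove r) :
    Function.Bijective ((p.insertNth r id : Fin (n + 1) → Fin n) ∘ α ∘ q.succAbove) := by
  rw [← Finite.injective_iff_bijective]
  -- The merging map has a single collision, between p and `p.succAbove r`. One of the two is α q,
  -- which is no longer a value once the source q is deleted.
  have key : ∀ a b : Fin (n + 1), a ≠ α q → b ≠ α q →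
      (p.insertNth r id : Fin (n + 1) → Fin n) a = (p.insertNth r id : Fin (n + 1) → Fin n) b →
      a = b := by
    intro a b ha hb hab
    rcases Fin.eq_self_or_eq_succAbove p a with ha' | ⟨a', ha'⟩ <;>
      rcases Fin.eq_self_or_eq_succAbove p b with hb' | ⟨b', hb'⟩ <;>
      simp only [ha', hb', Fin.insertNth_apply_same, Fin.insertNth_apply_succAbove, id] at hab ⊢
    · subst hab
      rcases h with h | h
      · exact absurd (ha'.trans h.symm) ha
      · exact absurd (hb'.trans h.symm) hb
    · subst hab
      rcases h with h | h
      · exact absurd (hb'.trans h.symm) hb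
      · exact absurd (ha'.trans h.symm) ha
    · rw [hab]
  intro x y hxy
  have hne : ∀ z, α (q.succAbove z) ≠ α q := fun z h => Fin.succAbove_ne q z (α.injective h)
  exact Fin.succAbove_right_injective (α.injective (key _ _ (hne x) (hne y) hxy))

/-- This is one summand of a commutator. If α q = p, the condition is void and i_p occurs nowhere in
the word, so summing over it gives a factor N. Otherwise the condition eliminates i_p. Either way
the weight of a permutation of n points remains. -/
theorem sum_ite_unitWord_succAbove_mem {n : ℕ}
    (ih : ∀ β : Perm (Fin n), glWeights β ∈ universalFamilies)
    (α : Perm (Fin (n + 1))) (p q : Fin (n + 1)) :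
    (fun N => ∑ i : Fin (n + 1) → Fin N, if i p = (i ∘ α) q
      then unitWord N (i ∘ p.succAbove) ((i ∘ α) ∘ q.succAbove) else 0) ∈ universalFamilies := by
  rcases Fin.eq_self_or_eq_succAbove p (α q) with h | ⟨r, h⟩
  · have hx : ∀ z, ∃ y, α (q.succAbove z) = p.succAbove y := fun z =>
      (Fin.eq_self_or_eq_succAbove p _).resolve_left fun h' =>
        Fin.succAbove_ne q z (α.injective (h'.trans h.symm))
    choose g hg using hx
    have hgi : Function.Injective g := fun x y hxy =>
      Fin.succAbove_right_injective (α.injective (by rw [hg, hg, hxy]))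
    let β := Equiv.ofBijective g (Finite.injective_iff_bijective.mp hgi)
    convert mul_mem natCast_mem_universalFamilies (ih β) using 1
    funext N
    rw [sum_insertNth p]
    have : ∀ (x : Fin N) (i : Fin n → Fin N),
        ((p.insertNth x i : Fin (n + 1) → Fin N) ∘ α) ∘ q.succAbove = i ∘ β := by
      intro x i
      funext z
      simp [hg, β]
    have h' : ∀ (x : Fin N) (i : Fin n → Fin N),
        (p.insertNth x i : Fin (n + 1) → Fin N) ∘ p.succAbove = i := by
      intro x i
      funext z
      simp
    simp [this, h', h, glWeights, glNWeight_eq_sum_unitWord]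
  · let β := Equiv.ofBijective _ (bijective_insertNth_comp α p q r (Or.inr h))
    convert ih β using 1
    funext N
    rw [sum_insertNth p, Finset.sum_comm, glWeights, glNWeight_eq_sum_unitWord]
    refine Finset.sum_congr rfl fun i _ => ?_
    have h' : ∀ x : Fin N,
        (p.insertNth x i : Fin (n + 1) → Fin N) ∘ p.succAbove = i := by
      intro x
      funext z
      simp
    simp only [h', h, Function.comp_apply, Fin.insertNth_apply_same, Fin.insertNth_apply_succAbove,
      Finset.sum_ite_eq', Finset.mem_univ, if_true, insertNth_comp_right]
    rfl

/-! ### Conjugation and multiplicativity -/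

/-- Renaming the summation indices by the transposition turns the conjugate's weight into the
original sum with two adjacent letters exchanged, so the difference is a sum of commutators. -/
theorem glWeights_sub_swap_conj_mem {n : ℕ}
    (ih : ∀ β : Perm (Fin n), glWeights β ∈ universalFamilies)
    (α : Perm (Fin (n + 1))) (k : Fin n) :
    glWeights α - glWeights (swap k.castSucc k.succ * α * (swap k.castSucc k.succ)⁻¹)
      ∈ universalFamilies := by
  convert sub_mem (sum_ite_unitWord_succAbove_mem ih α k.succ k.castSucc)
    (sum_ite_unitWord_succAbove_mem ih α k.castSucc k.succ) using 1
  funext N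
  simp only [Pi.sub_apply, glWeights, glNWeight_eq_sum_unitWord]
  rw [← ((swap k.castSucc k.succ).arrowCongr (Equiv.refl (Fin N))).sum_comp
    fun i => unitWord N i (i ∘ ⇑(swap k.castSucc k.succ * α * (swap k.castSucc k.succ)⁻¹)),
    ← Finset.sum_sub_distrib, ← Finset.sum_sub_distrib]
  refine Finset.sum_congr rfl fun i _ => ?_
  rw [← unitWord_sub_unitWord_swap]
  congr 2
  funext x
  simp [Equiv.arrowCongr]

theorem glWeights_conj_mem_iff {n : ℕ}
    (ih : ∀ β : Perm (Fin n), glWeights β ∈ universalFamilies)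
    (α π : Perm (Fin (n + 1))) :
    glWeights (π * α * π⁻¹) ∈ universalFamilies ↔ glWeights α ∈ universalFamilies := by
  -- Neighbouring transpositions generate the symmetric group.
  have hπ : π ∈ Submonoid.closure (Set.range fun i : Fin n ↦ swap i.castSucc i.succ) := by
    rw [Perm.mclosure_swap_castSucc_succ]; trivial
  induction hπ using Submonoid.closure_induction generalizing α with
  | mem x hx =>
    obtain ⟨k, rfl⟩ := hx
    have := glWeights_sub_swap_conj_mem ih α k
    constructor
    · intro h
      simpa using add_mem this h
    · intro h
      simpa using sub_mem h this
  | one => simp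
  | mul x y _ _ hx hy =>
    refine Iff.trans ?_ ((hx (y * α * y⁻¹)).trans (hy α))
    simp [mul_assoc]

/-- The disjoint union of two permutations, placed side by side. -/
def blockSum {a b : ℕ} (α : Perm (Fin a)) (β : Perm (Fin b)) : Perm (Fin (a + b)) :=
  finSumFinEquiv.permCongr (Perm.sumCongr α β)

theorem glWeights_blockSum {a b : ℕ} (α : Perm (Fin a)) (β : Perm (Fin b)) :
    glWeights (blockSum α β) = glWeights α * glWeights β := by
  funext N
  simp only [Pi.mul_apply, glWeights, glNWeight_eq_sum_unitWord]
  rw [← (Fin.appendEquiv a b).sum_comp, Fintype.sum_prod_type, Finset.sum_mul_sum]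
  refine Finset.sum_congr rfl fun i _ => Finset.sum_congr rfl fun j _ => ?_
  rw [← unitWord_append]
  congr 1
  funext x
  refine Fin.addCases (fun x => ?_) (fun x => ?_) x <;> simp [blockSum, Fin.appendEquiv]

theorem isConj_finRotate_of_forall_sameCycle {m : ℕ} (α : Perm (Fin m))
    (h : ∀ x y, α.SameCycle x y) : IsConj (finRotate m) α := by
  match m with
  | 0 => rw [Subsingleton.elim α (finRotate 0)]
  | 1 => rw [Subsingleton.elim α (finRotate 1)]
  -- `IsCycle` requires a moved point, hence the separate cases of at most one point.
  | m + 2 =>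
    have hfix : ∀ x, α x ≠ x := by
      intro x hx
      obtain ⟨y, hy⟩ := exists_ne x
      exact hy (((h x y).eq_of_left hx).symm)
    have hc : α.IsCycle := ⟨0, hfix 0, fun y _ => h 0 y⟩
    have hs : α.support = Finset.univ := by ext x; simp [hfix]
    rw [Perm.isConj_iff_cycleType_eq, hc.cycleType, isCycle_finRotate.cycleType,
      support_finRotate, hs]

/-- The cycle of x and its complement are α-invariant, and y makes the complement nonempty.
Numbering the cycle first and the complement after it is the conjugation. -/
theorem exists_blockSum_conj {m : ℕ} (α : Perm (Fin m)) {x y : Fin m} (h : ¬ α.SameCycle x y) :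
    ∃ (a b : ℕ) (hab : a + b = m) (β : Perm (Fin a)) (γ : Perm (Fin b)) (π : Perm (Fin m)),
      a < m ∧ b < m ∧ π * α * π⁻¹ = (finCongr hab).permCongr (blockSum β γ) := by
  classical
  let p : Fin m → Prop := α.SameCycle x
  have hp : ∀ z, p (α z) ↔ p z := fun z => Perm.sameCycle_apply_right
  have hab : Fintype.card {z // p z} + Fintype.card {z // ¬ p z} = m := by
    rw [Fintype.card_subtype_compl]
    have := Fintype.card_subtype_le p
    simp only [Fintype.card_fin] at this ⊢
    omega
  let e₁ := Fintype.equivFin {z // p z}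
  let e₂ := Fintype.equivFin {z // ¬ p z}
  let π : Perm (Fin m) := (Equiv.sumCompl p).symm.trans
    ((Equiv.sumCongr e₁ e₂).trans (finSumFinEquiv.trans (finCongr hab)))
  refine ⟨_, _, hab, e₁.permCongr (α.subtypePerm hp),
    e₂.permCongr (α.subtypePerm fun z => not_congr (hp z)), π, ?_, ?_, ?_⟩
  · have : 0 < Fintype.card {z // ¬ p z} := Fintype.card_pos_iff.mpr ⟨⟨y, h⟩⟩
    omega
  · have : 0 < Fintype.card {z // p z} := Fintype.card_pos_iff.mpr ⟨⟨x, Perm.SameCycle.refl _ _⟩⟩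
    omega
  · rw [mul_inv_eq_iff_eq_mul]
    ext z
    by_cases hz : p z
    · have hz' := (hp z).mpr hz
      simp [π, blockSum, Equiv.sumCompl_symm_apply_of_pos hz,
        Equiv.sumCompl_symm_apply_of_pos hz']
    · have hz' := mt (hp z).mp hz
      simp [π, blockSum, Equiv.sumCompl_symm_apply_of_neg hz,
        Equiv.sumCompl_symm_apply_of_neg hz']

theorem glWeights_finCongr_mem {a m : ℕ} (h : a = m) {α : Perm (Fin a)}
    (hα : glWeights α ∈ universalFamilies) :
    glWeights ((finCongr h).permCongr α) ∈ universalFamilies := by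
  subst h
  exact hα

/-- The values of the `gl(N)`-weight systems on a permutation are given by one polynomial in `N`
and the Casimir elements. -/
theorem glWeights_mem_universalFamilies (m : ℕ) (α : Perm (Fin m)) :
    glWeights α ∈ universalFamilies := by
  induction m using Nat.strong_induction_on with
  | _ m ih =>
    cases m with
    | zero =>
      rw [Subsingleton.elim α (finRotate 0)]
      exact glWeights_finRotate_mem 0
    | succ n =>
      have ihn := ih n n.lt_succ_self
      by_cases h : ∀ x y, α.SameCycle x y
      · obtain ⟨π, hπ⟩ := isConj_iff.mp (isConj_finRotate_of_forall_sameCycle α h)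
        rw [← hπ, glWeights_conj_mem_iff ihn]
        exact glWeights_finRotate_mem _
      · push Not at h
        obtain ⟨x, y, hxy⟩ := h
        obtain ⟨a, b, hab, β, γ, π, ha, hb, hπ⟩ := exists_blockSum_conj α hxy
        rw [← glWeights_conj_mem_iff ihn α π, hπ]
        have hmem := mul_mem (ih a ha β) (ih b hb γ)
        rw [← glWeights_blockSum] at hmem
        exact glWeights_finCongr_mem hab hmem

/-- The universal `gl`-weight system takes the values that characterize it. -/
theorem isUniversalValue_wgl {m : ℕ} (α : Perm (Fin m)) : IsUniversalValue α (wgl α) :=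
  Classical.epsilon_spec (exists_isUniversalValue (glWeights_mem_universalFamilies m α))

/-! ### Counting cycles -/

theorem numCycles_permCongr {ι κ : Type*} (e : ι ≃ κ) (α : Perm ι) :
    numCycles (e.permCongr α) = numCycles α := by
  refine (Nat.card_congr (Quotient.congr e fun x y => ?_)).symm
  change α.SameCycle x y ↔ (e.permCongr α).SameCycle (e x) (e y)
  refine exists_congr fun n => ?_
  rw [← Equiv.permCongrHom_coe, ← map_zpow]
  simp

theorem numCycles_eq_zero {ι : Type*} [IsEmpty ι] (α : Perm ι) : numCycles α = 0 := by
  have : IsEmpty (Quotient (Perm.SameCycle.setoid α)) :=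
    ⟨fun q => Quotient.inductionOn q fun x => isEmptyElim x⟩
  exact Nat.card_of_isEmpty

theorem numCycles_pos {ι : Type*} [Finite ι] [Nonempty ι] (α : Perm ι) : 0 < numCycles α := by
  have : Nonempty (Quotient (Perm.SameCycle.setoid α)) :=
    ⟨Quotient.mk _ (Classical.arbitrary ι)⟩
  exact Nat.card_pos

theorem finRotate_pow_apply {m : ℕ} (s : ℕ) (x : Fin m) (h : x.val + s < m) :
    ((finRotate m ^ s) x).val = x.val + s := by
  induction s with
  | zero => simp
  | succ s ih =>
    have ih := ih (by omega)
    rw [pow_succ', Perm.mul_apply]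
    cases m with
    | zero => exact x.elim0
    | succ m =>
      rw [coe_finRotate_of_ne_last, ih, add_assoc]
      intro h'
      have := congrArg Fin.val h'
      rw [ih, Fin.val_last] at this
      omega

theorem numCycles_finRotate (m : ℕ) : numCycles (finRotate (m + 1)) = 1 := by
  have key : ∀ x, (finRotate (m + 1)).SameCycle 0 x := fun x =>
    ⟨x.val, Fin.ext (by
      rw [zpow_natCast, finRotate_pow_apply _ _ (by rw [Fin.val_zero]; omega), Fin.val_zero,
        zero_add])⟩
  refine Nat.card_eq_one_iff_exists.mpr ⟨Quotient.mk _ 0, fun q => ?_⟩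
  exact Quotient.inductionOn q fun x => Quotient.sound (key x).symm

/-- The functions that are constant on the cycles of a permutation. -/
theorem card_comp_eq_self {ι : Type*} [Fintype ι] [DecidableEq ι] (N : ℕ) (π : Perm ι) :
    Fintype.card {x : ι → Fin N // x ∘ π = x} = N ^ numCycles π := by
  classical
  have hx : ∀ x : ι → Fin N, x ∘ π = x → ∀ a b, π.SameCycle a b → x a = x b := by
    intro x h a b hab
    obtain ⟨n, -, rfl⟩ := hab.exists_pow_eq'
    clear hab
    induction n with
    | zero => rfl
    | succ n ih => rw [ih, pow_succ', Perm.mul_apply]; exact (congrFun h _).symm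
  let e : {x : ι → Fin N // x ∘ π = x} ≃ (Quotient (Perm.SameCycle.setoid π) → Fin N) :=
    { toFun := fun x => Quotient.lift x.1 (hx x.1 x.2)
      invFun := fun g => ⟨fun a => g (Quotient.mk _ a), funext fun a =>
        congrArg g (Quotient.sound (Perm.sameCycle_apply_left.mpr (Perm.SameCycle.refl _ _)))⟩
      left_inv := fun x => rfl
      right_inv := fun g => funext fun q => Quotient.inductionOn q fun a => rfl }
  rw [Fintype.card_congr e, numCycles, Nat.card_eq_fintype_card]
  simp

/-! ### First entry of an orbit into a subset -/

section FirstIn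

variable {ι : Type*} {α : Perm ι} {U : Finset ι}

theorem apply_pow_of_forall_notMem {β : Type*} {i : ι → β} (hi : ∀ k ∉ U, i (α k) = i k)
    {k : ι} {n : ℕ} (h : ∀ l < n, (α ^ l) k ∉ U) : i ((α ^ n) k) = i k := by
  induction n with
  | zero => rfl
  | succ n ih =>
    rw [pow_succ', Perm.mul_apply, hi _ (h n n.lt_succ_self), ih fun l hl => h l (by omega)]

theorem exists_pow_apply_mem_iff {k : ι} (hk : k ∉ U) :
    (∃ n, (α ^ n) (α k) ∈ U) ↔ ∃ n, (α ^ n) k ∈ U := by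
  constructor
  · rintro ⟨n, hn⟩
    exact ⟨n + 1, hn⟩
  · rintro ⟨n, hn⟩
    cases n with
    | zero => exact absurd hn hk
    | succ n => exact ⟨n, hn⟩

variable [DecidableEq ι]

variable (α U) in
/-- The first element of the sequence `k, α k, α² k, …` that belongs to `U`. -/
def firstIn (k : ι) (h : ∃ n, (α ^ n) k ∈ U) : U := ⟨(α ^ Nat.find h) k, Nat.find_spec h⟩

theorem firstIn_of_mem (u : U) (h : ∃ n, (α ^ n) (u : ι) ∈ U) : firstIn α U u h = u := by
  have : Nat.find h = 0 := (Nat.find_eq_zero h).mpr u.2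
  exact Subtype.ext (by simp [firstIn, this])

theorem firstIn_apply {k : ι} (hk : k ∉ U) (h : ∃ n, (α ^ n) (α k) ∈ U)
    (h' : ∃ n, (α ^ n) k ∈ U) : firstIn α U (α k) h = firstIn α U k h' := by
  have : Nat.find h' = Nat.find h + 1 :=
    Nat.find_comp_succ h' h hk
  exact Subtype.ext (by simp only [firstIn, this]; rfl)

end FirstIn

/-! ### Induced permutations and functions constant off a subset -/

section Induced

variable {ι : Type*} [Fintype ι] [DecidableEq ι] (α : Perm ι) (U : Finset ι)

theorem nextIn_eq_of {u v : U} {t : ℕ} (h : (α ^ (t + 1)) (u : ι) = v)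
    (h' : ∀ s < t, (α ^ (s + 1)) (u : ι) ∉ U) : nextIn α U u = v := by
  have : Nat.find (exists_return α U u) = t :=
    (Nat.find_eq_iff _).mpr ⟨h ▸ v.2, h'⟩
  exact Subtype.ext (by simp only [nextIn, this, h])

theorem sameCycle_inducedPerm_apply (u : U) : α.SameCycle u (inducedPerm α U u) :=
  ⟨(Nat.find (exists_return α U u) + 1 : ℕ), by rw [zpow_natCast]; rfl⟩

theorem sameCycle_inducedPerm {u v : U} :
    (inducedPerm α U).SameCycle u v ↔ α.SameCycle (u : ι) v := by
  constructor
  · intro h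
    obtain ⟨n, -, rfl⟩ := h.exists_pow_eq'
    clear h
    induction n with
    | zero => exact Perm.SameCycle.refl _ _
    | succ n ih =>
      rw [pow_succ', Perm.mul_apply]
      exact ih.trans (sameCycle_inducedPerm_apply α U _)
  · intro h
    obtain ⟨n, -, hn⟩ := h.exists_pow_eq'
    clear h
    -- Induction on the number of α-steps from u to v: the first return to U uses up at least one of
    -- them.
    induction n using Nat.strong_induction_on generalizing u with
    | _ n ih =>
      cases n with
      | zero =>
        obtain rfl : u = v := Subtype.ext (by simpa using hn)
        exact Perm.SameCycle.refl _ _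
      | succ n =>
        have hle : Nat.find (exists_return α U u) ≤ n := Nat.find_min' _ (hn ▸ v.2)
        rw [← Perm.sameCycle_apply_left]
        refine ih (n - Nat.find (exists_return α U u)) (by omega) ?_
        rw [← hn]
        change (α ^ _) ((α ^ _) (u : ι)) = _
        rw [← Perm.mul_apply, ← pow_add]
        congr 2
        omega

/-- The map from the cycles of the induced permutation of `U` to the cycles of `α`. -/
noncomputable def cycleMap : Quotient (Perm.SameCycle.setoid (inducedPerm α U)) →
    Quotient (Perm.SameCycle.setoid α) :=
  Quotient.map Subtype.val fun _ _ h => (sameCycle_inducedPerm α U).mp h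

theorem cycleMap_injective : Function.Injective (cycleMap α U) := by
  intro p q
  refine Quotient.inductionOn₂ p q fun u v h => Quotient.sound ?_
  exact (sameCycle_inducedPerm α U).mpr (Quotient.exact h)

theorem mk_mem_range_cycleMap {k : ι} :
    Quotient.mk (Perm.SameCycle.setoid α) k ∈ Set.range (cycleMap α U) ↔ ∃ n, (α ^ n) k ∈ U := by
  constructor
  · rintro ⟨q, hq⟩
    induction q using Quotient.inductionOn with
    | _ u =>
      have h : α.SameCycle u k := Quotient.exact hq
      obtain ⟨n, -, hn⟩ := h.symm.exists_pow_eq'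
      exact ⟨n, hn ▸ u.2⟩
  · rintro ⟨n, hn⟩
    refine ⟨Quotient.mk _ ⟨_, hn⟩, Quotient.sound ?_⟩
    exact Perm.SameCycle.symm ⟨n, by simp⟩

/-- The cycles outside the range are those missing U. Since `cycleMap` is injective, the truncated
subtraction is exact. -/
theorem card_compl_range_cycleMap :
    Nat.card ↥(Set.range (cycleMap α U))ᶜ = numCycles α - numCycles (inducedPerm α U) := by
  have h := Set.ncard_add_ncard_compl (Set.range (cycleMap α U))
  rw [← Nat.card_coe_set_eq, ← Nat.card_coe_set_eq,
    Nat.card_range_of_injective (cycleMap_injective α U)] at h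
  exact (Nat.sub_eq_of_eq_add' h.symm).symm

/-- A function that changes along `α` only at the points of `U` is given by its values on `U` and
on the cycles of `α` that do not meet `U`. -/
noncomputable def constOffEquiv (β : Type*) :
    {i : ι → β // ∀ k ∉ U, i (α k) = i k}
      ≃ (U → β) × (↥(Set.range (cycleMap α U))ᶜ → β) := by
  classical
  exact
  { toFun := fun i => (fun u => i.1 u, fun d => i.1 d.1.out)
    -- Values propagate backwards along α from U: a point takes the value at the first element of U
    -- on its forward orbit, if there is one, and otherwise the value of its cycle.
    invFun := fun p => ⟨fun k => if h : ∃ n, (α ^ n) k ∈ U then p.1 (firstIn α U k h)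
        else p.2 ⟨Quotient.mk _ k, fun h' => h ((mk_mem_range_cycleMap α U).mp h')⟩, by
      intro k hk
      by_cases h : ∃ n, (α ^ n) k ∈ U
      · have h' := (exists_pow_apply_mem_iff hk).mpr h
        simp only [dif_pos h, dif_pos h', firstIn_apply hk h' h]
      · have h' := mt (exists_pow_apply_mem_iff hk).mp h
        simp only [dif_neg h, dif_neg h']
        refine congrArg p.2 (Subtype.ext ?_)
        exact Quotient.sound (s := Perm.SameCycle.setoid α) (Perm.sameCycle_apply_left.mpr (Perm.SameCycle.refl _ _))⟩
    left_inv := by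
      rintro ⟨i, hi⟩
      refine Subtype.ext (funext fun k => ?_)
      by_cases h : ∃ n, (α ^ n) k ∈ U
      · simp only [dif_pos h]
        exact apply_pow_of_forall_notMem hi fun l hl => Nat.find_min h hl
      · simp only [dif_neg h]
        have hs : α.SameCycle k (Quotient.mk (Perm.SameCycle.setoid α) k).out :=
          (Quotient.mk_out (s := Perm.SameCycle.setoid α) k).symm
        obtain ⟨n, -, hn⟩ := hs.exists_pow_eq'
        rw [← hn]
        exact apply_pow_of_forall_notMem hi fun l _ hl => h ⟨l, hl⟩
    right_inv := by
      rintro ⟨x, g⟩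
      refine Prod.ext (funext fun u => ?_) (funext fun d => ?_)
      · have h : ∃ n, (α ^ n) (u : ι) ∈ U := ⟨0, u.2⟩
        simp only [dif_pos h, firstIn_of_mem]
      · have hd : Quotient.mk (Perm.SameCycle.setoid α) d.1.out = d.1 := Quotient.out_eq _
        have h : ¬ ∃ n, (α ^ n) d.1.out ∈ U := fun h =>
          d.2 (hd ▸ (mk_mem_range_cycleMap α U).mpr h)
        simp only [dif_neg h]
        congr 1
        exact Subtype.ext hd }

/-- Starting from α u, the value cannot change before the orbit returns to U, which happens at the
image of u under the induced permutation. -/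
theorem constOffEquiv_apply_mem {β : Type*} (i : {i : ι → β // ∀ k ∉ U, i (α k) = i k}) (u : U) :
    i.1 (α u) = (constOffEquiv α U β i).1 (inducedPerm α U u) := by
  refine (apply_pow_of_forall_notMem (n := Nat.find (exists_return α U u)) i.2
    fun l hl => ?_).symm
  exact Nat.find_min (exists_return α U u) hl

/-- Summation over the functions that change along `α` only at the points of `U`. -/
theorem sum_ite_constOff (N : ℕ) [DecidablePred fun i : ι → Fin N => ∀ k ∉ U, i (α k) = i k]
    (F : (U → Fin N) → (U → Fin N) → ℂ) :
    (∑ i : ι → Fin N, if ∀ k ∉ U, i (α k) = i k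
        then F (fun u => i u) (fun u => i (α u)) else 0)
      = (N : ℂ) ^ (numCycles α - numCycles (inducedPerm α U))
        * ∑ x : U → Fin N, F x (x ∘ inducedPerm α U) := by
  classical
  rw [← Finset.sum_filter, ← Finset.sum_subtype_eq_sum_filter, Finset.subtype_univ]
  have h : ∀ i : {i : ι → Fin N // ∀ k ∉ U, i (α k) = i k},
      F (fun u => i.1 u) (fun u => i.1 (α u))
        = F (constOffEquiv α U _ i).1 ((constOffEquiv α U _ i).1 ∘ inducedPerm α U) := by
    intro i
    congr 1
    funext u
    exact constOffEquiv_apply_mem α U i u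
  simp only [h]
  rw [(constOffEquiv α U (Fin N)).sum_comp fun p => F p.1 (p.1 ∘ inducedPerm α U),
    Fintype.sum_prod_type, Finset.mul_sum]
  refine Finset.sum_congr rfl fun x _ => ?_
  dsimp only
  rw [Finset.sum_const, nsmul_eq_mul, Finset.card_univ, Fintype.card_fun, Fintype.card_fin,
    ← Nat.card_eq_fintype_card, card_compl_range_cycleMap, Nat.cast_pow]

end Induced

/-! ### Faces of subpermutations -/

theorem numCycles_subPerm {m : ℕ} (α : Perm (Fin m)) (U : Finset (Fin m)) :
    numCycles (subPerm α U) = numCycles (inducedPerm α U) :=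
  numCycles_permCongr _ _

theorem eq_of_forall_castSucc_apply_eq {n : ℕ} {f g : Perm (Fin (n + 1))}
    (h : ∀ l : Fin n, f l.castSucc = g l.castSucc) : f = g := by
  ext x
  congr 1
  cases x using Fin.lastCases with
  | cast l => exact h l
  | last =>
    obtain ⟨y, hy⟩ := g.surjective (f (Fin.last n))
    rw [← hy]
    cases y using Fin.lastCases with
    | cast l =>
      rw [← h] at hy
      exact absurd (f.injective hy) (Fin.castSucc_lt_last l).ne
    | last => rfl

/-- Between neighbouring elements of U the rotation passes only through points outside U, so it
induces l ↦ l + 1; the image of the last element is then forced. -/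
theorem subPerm_finRotate {m : ℕ} (U : Finset (Fin m)) :
    subPerm (finRotate m) U = finRotate U.card := by
  have key : ∀ l l' : Fin U.card, l'.val = l.val + 1 → subPerm (finRotate m) U l = l' := by
    intro l l' hl
    let e := U.orderIsoOfFin rfl
    change e.symm (nextIn (finRotate m) U (e l)) = l'
    rw [OrderIso.symm_apply_eq]
    have hlt : (e l : Fin m).val < (e l' : Fin m).val :=
      e.strictMono (Fin.lt_def.mpr (by omega))
    have hm := (e l' : Fin m).isLt
    refine nextIn_eq_of _ _ (t := (e l' : Fin m).val - (e l : Fin m).val - 1)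
      (Fin.ext ?_) fun s hs hmem => ?_
    · rw [finRotate_pow_apply _ _ (by omega)]
      omega
    · obtain ⟨j, hj⟩ := e.surjective ⟨_, hmem⟩
      have hv : (e j : Fin m).val = (e l : Fin m).val + (s + 1) := by
        rw [hj]
        exact finRotate_pow_apply _ _ (by omega)
      have h1 : e l < e j := Subtype.coe_lt_coe.mp (Fin.lt_def.mpr (by omega))
      have h2 : e j < e l' := Subtype.coe_lt_coe.mp (Fin.lt_def.mpr (by omega))
      rw [e.lt_iff_lt, Fin.lt_def] at h1 h2
      omega
  generalize subPerm (finRotate m) U = f at key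
  generalize U.card = n at f key
  cases n with
  | zero => exact Subsingleton.elim _ _
  | succ n =>
    refine eq_of_forall_castSucc_apply_eq fun l => ?_
    rw [key l.castSucc l.succ (by simp), finRotate_apply, Fin.coeSucc_eq_succ]

theorem numFaces_subPerm {m : ℕ} (α : Perm (Fin m)) {U : Finset (Fin m)} (hU : U.Nonempty) :
    numFaces (subPerm α U)
      = numCycles ((inducedPerm α U)⁻¹ * inducedPerm (finRotate m) U) := by
  rw [numFaces, if_neg hU.card_pos.ne', ← subPerm_finRotate U, subPerm, subPerm,
    ← Equiv.permCongrHom_coe, ← map_inv, ← map_mul, Equiv.permCongrHom_coe, numCycles_permCongr]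

theorem numFaces_pos {m : ℕ} (α : Perm (Fin m)) : 0 < numFaces α := by
  unfold numFaces
  split_ifs with h
  · exact one_pos
  · have : Nonempty (Fin m) := ⟨⟨0, Nat.pos_of_ne_zero h⟩⟩
    exact numCycles_pos _

/-- The number of faces of a subpermutation, in terms of the induced permutations. -/
theorem numFaces_subPerm_eq {m : ℕ} (α : Perm (Fin (m + 1))) (U : Finset (Fin (m + 1))) :
    numFaces (subPerm α U) = (numCycles (finRotate (m + 1))
        - numCycles (inducedPerm (finRotate (m + 1)) U))
      + numCycles ((inducedPerm α U)⁻¹ * inducedPerm (finRotate (m + 1)) U) := by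
  rw [numCycles_finRotate]
  -- For empty U the single cycle of the rotation misses U and supplies the conventional face of the
  -- empty permutation; for nonempty U the subtracted term is 0.
  rcases U.eq_empty_or_nonempty with rfl | hU
  · rw [numCycles_eq_zero, numCycles_eq_zero]
    simp [numFaces]
  · have : Nonempty U := hU.to_subtype
    rw [numFaces_subPerm α hU, Nat.sub_eq_zero_of_le (numCycles_pos _), zero_add]

/-! ### The standard representation twisted by a multiple of the trace -/

/-- The representation of `U gl(N)` on `ℂ^N` with `E_{ij} ↦ e_{ij} + ε δ_{ij}`. -/
noncomputable def twistedRep (N : ℕ) (ε : ℂ) : Ugl N →ₐ[ℂ] Matrix (Fin N) (Fin N) ℂ :=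
  UniversalEnvelopingAlgebra.lift ℂ
    { toFun := fun x => x + (ε * x.trace) • (1 : Matrix (Fin N) (Fin N) ℂ)
      map_add' := fun x y => by
        rw [Matrix.trace_add, mul_add, add_smul]
        abel
      map_smul' := fun c x => by
        rw [Matrix.trace_smul, smul_eq_mul, RingHom.id_apply, smul_add, smul_smul]
        congr 2
        ring
      -- Commutators have trace zero, and scalar matrices commute with everything.
      map_lie' := fun {x y} => by
        rw [Ring.lie_def, Ring.lie_def, Matrix.trace_sub, Matrix.trace_mul_comm, sub_self, mul_zero,
          zero_smul, add_zero]
        simp only [add_mul, mul_add, smul_mul_assoc, mul_smul_comm, one_mul, mul_one]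
        simp only [smul_add, smul_comm (ε * y.trace) (ε * x.trace)]
        abel }

theorem twistedRep_unit (N : ℕ) (ε : ℂ) (i j : Fin N) :
    twistedRep N ε (unit N i j)
      = Matrix.single i j 1 + if i = j then ε • (1 : Matrix (Fin N) (Fin N) ℂ) else 0 := by
  rw [twistedRep, unit, UniversalEnvelopingAlgebra.lift_ι_apply]
  change Matrix.single i j (1 : ℂ) + (ε * (Matrix.single i j (1 : ℂ)).trace)
    • (1 : Matrix (Fin N) (Fin N) ℂ) = _
  congr 1
  split_ifs with h
  · subst h; simp
  · simp [Matrix.trace_single_eq_of_ne _ _ _ h]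

theorem twistedRep_unit_apply (N : ℕ) (ε : ℂ) (i j p q : Fin N) :
    twistedRep N ε (unit N i j) p q
      = (if p = i ∧ q = j then 1 else 0) + if i = j ∧ p = q then ε else 0 := by
  rw [twistedRep_unit, Matrix.add_apply, Matrix.single_apply]
  congr 1
  · simp only [eq_comm]
  · by_cases h : i = j
    · by_cases h' : p = q <;> simp [h, h']
    · simp [h]

/-- The matrix T of operators e_ab satisfies T² = N T, because ∑_c e_ac e_cb = N e_ab. Hence (T +
ε)^n = (((N + ε)^n - ε^n) / N) T + ε^n. -/
theorem twistedRep_unitMatrix_pow (N : ℕ) [NeZero N] (ε : ℂ) (n : ℕ) (a b : Fin N) :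
    twistedRep N ε ((unitMatrix N ^ n) a b)
      = ((((N : ℂ) + ε) ^ n - ε ^ n) / N) • Matrix.single a b (1 : ℂ)
        + if a = b then ε ^ n • (1 : Matrix (Fin N) (Fin N) ℂ) else 0 := by
  induction n generalizing b with
  | zero =>
    by_cases h : a = b
    · subst h; simp
    · simp [h]
  | succ n ih =>
    have hN : (N : ℂ) ≠ 0 := NeZero.ne _
    rw [pow_succ, Matrix.mul_apply, map_sum]
    have hu : ∀ c, unitMatrix N c b = unit N c b := fun c => rfl
    simp only [map_mul, ih, hu, twistedRep_unit]
    simp only [add_mul, mul_add, ite_mul, mul_ite, zero_mul, mul_zero, smul_mul_assoc,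
      mul_smul_comm, one_mul, mul_one, Finset.sum_add_distrib, Finset.sum_ite_eq,
      Finset.sum_ite_eq', Finset.mem_univ, if_true, Matrix.single_mul_single_same,
      Finset.sum_const, Finset.card_univ, Fintype.card_fin]
    rw [← Nat.cast_smul_eq_nsmul ℂ, smul_smul, smul_add, smul_smul, ← add_smul, ← add_assoc,
      ← add_smul, smul_ite, smul_zero, smul_smul, ← pow_succ']
    congr 2
    field_simp
    ring

/-- The scalar by which the `k`-th Casimir element acts in the twisted representation. -/
theorem twistedRep_casimir (N : ℕ) [NeZero N] (ε : ℂ) (k : ℕ) :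
    twistedRep N ε (casimir N (k + 1))
      = (MvPolynomial.eval ![(N : ℂ), ε] (casimirSubst (k + 1))) • 1 := by
  have hN : (N : ℂ) ≠ 0 := NeZero.ne _
  rw [casimir_succ, Matrix.trace, map_sum]
  simp only [Matrix.diag_apply, twistedRep_unitMatrix_pow, if_true, Finset.sum_add_distrib]
  -- The diagonal units sum to the identity, and the term ε^(k+1) is counted N times; this is the
  -- source of 1 - N² in the substitution.
  rw [← Finset.smul_sum, Matrix.sum_single_one, Finset.sum_const, Finset.card_univ,
    Fintype.card_fin, ← Nat.cast_smul_eq_nsmul ℂ, smul_smul, ← add_smul]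
  congr 1
  refine mul_left_cancel₀ hN ?_
  have h := congrArg (MvPolynomial.eval ![(N : ℂ), ε]) (varN_mul_casimirSubst (k + 1))
  simp only [varN, varE, map_mul, map_sub, map_add, map_pow, map_one, MvPolynomial.eval_X,
    Matrix.cons_val_zero, Matrix.cons_val_one] at h
  rw [h]
  field_simp
  ring

theorem twistedRep_aeval_casimirPoint (N : ℕ) [NeZero N] (ε : ℂ) (P : MvPolynomial ℕ ℂ) :
    twistedRep N ε (MvPolynomial.aeval (casimirPoint N) P : Subalgebra.center ℂ (Ugl N))
      = (MvPolynomial.eval ![(N : ℂ), ε]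
        (MvPolynomial.aeval (fun k : ℕ => if k = 0 then varN else casimirSubst k) P)) • 1 := by
  have h : ((twistedRep N ε).comp (Subalgebra.center ℂ (Ugl N)).val).comp
        (MvPolynomial.aeval (casimirPoint N))
      = (Algebra.ofId ℂ (Matrix (Fin N) (Fin N) ℂ)).comp
        ((MvPolynomial.aeval ![(N : ℂ), ε]).comp
          (MvPolynomial.aeval fun k : ℕ => if k = 0 then varN else casimirSubst k)) := by
    refine MvPolynomial.algHom_ext fun k => ?_
    cases k with
    | zero => simp [casimirPoint, varN]
    | succ k =>
      simp only [AlgHom.comp_apply, MvPolynomial.aeval_X, casimirPoint, if_neg k.succ_ne_zero,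
        Subalgebra.coe_val, twistedRep_casimir, Algebra.ofId_apply, Algebra.algebraMap_eq_smul_one,
        MvPolynomial.aeval_eq_eval]
  have := DFunLike.congr_fun h P
  simpa only [AlgHom.comp_apply, Subalgebra.coe_val, Algebra.ofId_apply,
    Algebra.algebraMap_eq_smul_one, MvPolynomial.aeval_eq_eval] using this

/-! ### Traces of products of matrices -/

theorem list_prod_ofFn_apply {N n : ℕ} (M : Fin (n + 1) → Matrix (Fin N) (Fin N) ℂ) (a b : Fin N) :
    (List.ofFn M).prod a b = ∑ i : Fin n → Fin N,
      ∏ k, M k ((Fin.cons a i : Fin (n + 1) → Fin N) k)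
        ((Fin.snoc i b : Fin (n + 1) → Fin N) k) := by
  induction n generalizing a with
  | zero => simp [Fin.snoc]
  | succ n ih =>
    rw [List.ofFn_succ, List.prod_cons, Matrix.mul_apply,
      ← (Fin.consEquiv fun _ : Fin (n + 1) => Fin N).sum_comp, Fintype.sum_prod_type]
    refine Finset.sum_congr rfl fun c _ => ?_
    rw [ih, Finset.mul_sum]
    refine Finset.sum_congr rfl fun i _ => ?_
    rw [Fin.prod_univ_succ (n := n + 1)]
    simp [Fin.consEquiv, ← Fin.cons_snoc_eq_snoc_cons]

/-- The trace closes the path of matrix indices into a loop, which is where the standard cycle σ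
enters. -/
theorem trace_list_prod_ofFn {N n : ℕ} (M : Fin (n + 1) → Matrix (Fin N) (Fin N) ℂ) :
    (List.ofFn M).prod.trace
      = ∑ j : Fin (n + 1) → Fin N, ∏ k, M k (j k) (j (finRotate (n + 1) k)) := by
  simp only [Matrix.trace, Matrix.diag_apply, list_prod_ofFn_apply]
  rw [← (Fin.consEquiv fun _ : Fin (n + 1) => Fin N).sum_comp, Fintype.sum_prod_type]
  refine Finset.sum_congr rfl fun a _ => Finset.sum_congr rfl fun i _ => ?_
  simp only [Fin.snoc_eq_cons_rotate]
  rfl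

theorem twistedRep_glNWeight (N : ℕ) (ε : ℂ) {m : ℕ} (α : Perm (Fin m)) :
    twistedRep N ε (glNWeight N α)
      = ∑ i : Fin m → Fin N, (List.ofFn fun k => twistedRep N ε (unit N (i k) (i (α k)))).prod := by
  rw [glNWeight, map_sum]
  refine Finset.sum_congr rfl fun i _ => ?_
  rw [map_list_prod, List.map_ofFn]
  rfl

/-- The contribution of a subset `U` to the trace of `w_{gl(N)}(α)` in the twisted
representation. -/
theorem sum_prod_ite_eq {m : ℕ} (α σ : Perm (Fin m)) (N : ℕ) (ε : ℂ) (U : Finset (Fin m)) :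
    (∑ i : Fin m → Fin N, ∑ j : Fin m → Fin N,
      (∏ k ∈ U, if j k = i k ∧ j (σ k) = i (α k) then (1 : ℂ) else 0)
        * ∏ k ∈ Finset.univ \ U, if i k = i (α k) ∧ j k = j (σ k) then ε else 0)
      = (N : ℂ) ^ ((numCycles α - numCycles (inducedPerm α U))
          + ((numCycles σ - numCycles (inducedPerm σ U))
            + numCycles ((inducedPerm α U)⁻¹ * inducedPerm σ U))) * ε ^ (m - U.card) := by
  let G : (U → Fin N) → (U → Fin N) → (U → Fin N) → (U → Fin N) → ℂ :=
    fun x x' y y' => if y = x ∧ y' = x' then ε ^ (m - U.card) else 0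
  have h : ∀ i j : Fin m → Fin N,
      (∏ k ∈ U, if j k = i k ∧ j (σ k) = i (α k) then (1 : ℂ) else 0)
        * (∏ k ∈ Finset.univ \ U, if i k = i (α k) ∧ j k = j (σ k) then ε else 0)
      = if ∀ k ∉ U, i (α k) = i k then (if ∀ k ∉ U, j (σ k) = j k then
          G (fun u => i u) (fun u => i (α u)) (fun u => j u) (fun u => j (σ u)) else 0)
        else 0 := by
    intro i j
    rw [Finset.prod_ite_zero, Finset.prod_ite_zero, Finset.prod_const, Finset.prod_const, one_pow,
      Finset.card_univ_sdiff, Fintype.card_fin, ite_mul, one_mul, zero_mul]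
    have h1 : (∀ k ∈ U, j k = i k ∧ j (σ k) = i (α k)) ↔
        (fun u : U => j u) = (fun u : U => i u)
          ∧ (fun u : U => j (σ u)) = (fun u : U => i (α u)) := by
      simp only [funext_iff, Subtype.forall]
      exact ⟨fun h => ⟨fun k hk => (h k hk).1, fun k hk => (h k hk).2⟩,
        fun h k hk => ⟨h.1 k hk, h.2 k hk⟩⟩
    have h2 : (∀ k ∈ Finset.univ \ U, i k = i (α k) ∧ j k = j (σ k)) ↔
        (∀ k ∉ U, i (α k) = i k) ∧ ∀ k ∉ U, j (σ k) = j k := by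
      simp only [Finset.mem_sdiff, Finset.mem_univ, true_and]
      exact ⟨fun h => ⟨fun k hk => (h k hk).1.symm, fun k hk => (h k hk).2.symm⟩,
        fun h k hk => ⟨(h.1 k hk).symm, (h.2 k hk).symm⟩⟩
    simp only [h1, h2, G, ← ite_and]
    congr 1
    apply propext
    tauto
  simp only [h]
  -- The sum over j is taken first, along σ with i fixed; the sum over i along α follows.
  have h3 : ∀ i : Fin m → Fin N, (∑ j : Fin m → Fin N,
      if ∀ k ∉ U, i (α k) = i k then (if ∀ k ∉ U, j (σ k) = j k then
          G (fun u => i u) (fun u => i (α u)) (fun u => j u) (fun u => j (σ u)) else 0)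
        else 0) = if ∀ k ∉ U, i (α k) = i k then
          (N : ℂ) ^ (numCycles σ - numCycles (inducedPerm σ U))
            * ∑ y : U → Fin N, G (fun u => i u) (fun u => i (α u)) y (y ∘ inducedPerm σ U)
        else 0 := by
    intro i
    split_ifs
    · exact sum_ite_constOff σ U N (G (fun u => i u) (fun u => i (α u)))
    · simp
  simp only [h3]
  rw [sum_ite_constOff α U N fun x x' =>
    (N : ℂ) ^ (numCycles σ - numCycles (inducedPerm σ U))
      * ∑ y : U → Fin N, G x x' y (y ∘ inducedPerm σ U), ← Finset.mul_sum, pow_add, pow_add]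
  -- Gluing forces y = x, leaving only the compatibility of x with both induced permutations.
  have h4 : ∀ x : U → Fin N, (∑ y : U → Fin N,
      G x (x ∘ inducedPerm α U) y (y ∘ inducedPerm σ U))
        = if x ∘ inducedPerm σ U = x ∘ inducedPerm α U then ε ^ (m - U.card) else 0 := by
    intro x
    simp only [G, ite_and, Finset.sum_ite_eq', Finset.mem_univ, if_true]
  simp only [h4]
  -- Replacing x by x ∘ (α|_U)⁻¹ turns the condition into invariance of x under (α|_U)⁻¹ σ|_U, so
  -- the count is N to the number of its cycles.
  rw [← ((inducedPerm α U).arrowCongr (Equiv.refl (Fin N))).sum_comp fun x : U → Fin N =>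
    if x ∘ inducedPerm σ U = x ∘ inducedPerm α U then ε ^ (m - U.card) else 0]
  have h5 : ∀ x : U → Fin N,
      ((inducedPerm α U).arrowCongr (Equiv.refl (Fin N)) x ∘ inducedPerm σ U
        = (inducedPerm α U).arrowCongr (Equiv.refl (Fin N)) x ∘ inducedPerm α U)
      ↔ x ∘ ((inducedPerm α U)⁻¹ * inducedPerm σ U : Perm U) = x := by
    intro x
    have e1 : (inducedPerm α U).arrowCongr (Equiv.refl (Fin N)) x ∘ inducedPerm α U = x := by
      funext u
      simp [Equiv.arrowCongr]
    rw [e1]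
    rfl
  simp only [h5]
  rw [← Finset.sum_filter, Finset.sum_const, nsmul_eq_mul, ← Fintype.card_subtype,
    card_comp_eq_self, Nat.cast_pow, mul_assoc, mul_assoc]

theorem trace_twistedRep_glNWeight (N : ℕ) (ε : ℂ) {m : ℕ} (α : Perm (Fin m)) :
    (twistedRep N ε (glNWeight N α)).trace = ∑ U : Finset (Fin m),
      (N : ℂ) ^ (numCycles α - numCycles (subPerm α U) + numFaces (subPerm α U))
        * ε ^ (m - U.card) := by
  rw [twistedRep_glNWeight]
  cases m with
  -- The loop formula for the trace needs a nonempty word. The empty product has trace N, matching f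
  -- = 1.
  | zero =>
    have hd : (default : Finset (Fin 0)) = ∅ := Subsingleton.elim _ _
    rw [Fintype.sum_unique, Fintype.sum_unique, hd]
    simp [numCycles_eq_zero, numFaces]
  | succ m =>
    rw [Matrix.trace_sum]
    -- Expanding the product of binomials makes U the set of letters from which the matrix unit is
    -- chosen.
    simp only [trace_list_prod_ofFn, twistedRep_unit_apply, Finset.prod_add,
      Finset.powerset_univ]
    simp only [Finset.sum_comm (t := (Finset.univ : Finset (Finset (Fin (m + 1)))))]
    refine Finset.sum_congr rfl fun U _ => ?_
    rw [sum_prod_ite_eq, numCycles_subPerm, numFaces_subPerm_eq]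

theorem eval_Feps (N : ℕ) [NeZero N] (ε : ℂ) {m : ℕ} (α : Perm (Fin m)) :
    MvPolynomial.eval ![(N : ℂ), ε] (Feps α) = ∑ U : Finset (Fin m),
      (N : ℂ) ^ (numCycles α - numCycles (subPerm α U) + numFaces (subPerm α U) - 1)
        * ε ^ (m - U.card) := by
  have hN : (N : ℂ) ≠ 0 := NeZero.ne _
  refine mul_left_cancel₀ hN ?_
  have h := trace_twistedRep_glNWeight N ε α
  rw [← isUniversalValue_wgl α N NeZero.one_le, twistedRep_aeval_casimirPoint, Matrix.trace_smul,
    Matrix.trace_one, Fintype.card_fin, smul_eq_mul, mul_comm] at h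
  rw [Feps, h, Finset.mul_sum]
  refine Finset.sum_congr rfl fun U _ => ?_
  rw [← mul_assoc, ← pow_succ', Nat.sub_add_cancel]
  -- There is at least one face, so the truncated - 1 in the exponent is a true division by N.
  exact Nat.le_add_left_of_le (numFaces_pos _)

theorem infinite_range_natCast_succ : (Set.range fun n : ℕ => ((n + 1 : ℕ) : ℂ)).Infinite :=
  Set.infinite_range_of_injective fun _ _ h => Nat.succ_injective (Nat.cast_injective h)

end GlWeight

open GlWeight in
theorem mainTheorem3 (m : ℕ) (α : Equiv.Perm (Fin m)) :
    IsUniversalValue α (wgl α) ∧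
      Feps α = ∑ U : Finset (Fin m),
        varN ^ (numCycles α - numCycles (subPerm α U) + numFaces (subPerm α U) - 1)
          * varE ^ (m - U.card) := by
  refine ⟨isUniversalValue_wgl α, ?_⟩
  -- Polynomials agreeing on a product of infinite sets are equal; here N runs over the positive
  -- integers and ε over ℂ.
  refine MvPolynomial.funext_set ![Set.range fun n : ℕ => ((n + 1 : ℕ) : ℂ), Set.univ] ?_ ?_
  · intro i
    fin_cases i
    · exact infinite_range_natCast_succ
    · exact Set.infinite_univ
  · intro x hx
    obtain ⟨n, hn⟩ := hx 0 trivial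
    have hx' : x = ![((n + 1 : ℕ) : ℂ), x 1] := by
      funext i
      fin_cases i
      · exact hn.symm
      · rfl
    rw [hx', eval_Feps]
    simp [varN, varE]
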